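/- Let $R$ be a commutative ring with identity; all modules are unital $R$-modules. Definitions. A finitely generated ideal $J$ of $R$ is a GV-ideal if the natural map $R\to \mathrm{Hom}_R(J,R)$, $r\mapsto (a\mapsto ra)$, is an isomorphism. A module $M$ is GV-torsion-free if no nonzero $x\in M$ satisfies $Jx=0$ for some GV-ideal $J$; it is a $w$-module if moreover $\mathrm{Ext}^1_R(R/J,M)=0$ for every GV-ideal $J$. A $w$-ideal is an ideal of $R$ that is a $w$-module, and a maximal $w$-ideal is a maximal element of the set of proper $w$-ideals (maximal $w$-ideals are prime). $R$ is a DW-ring if every ideal of $R$ is a $w$-ideal. A sequence $0\to A\to B\to C\to 0$ of modules is $w$-exact if $0\to A_{\mathfrak p}\to B_{\mathfrak p}\to C_{\mathfrak p}\to 0$ is exact for every maximal $w$-ideal $\mathfrak p$; it is $w$-pure exact if it is $w$-exact and, for every module $M$, the sequence $0\to A\otimes_R M\to B\otimes_R M\to C\otimes_R M\to 0$ is $w$-exact. A module $A$ is absolutely $w$-pure if for every module $B$ containing $A$ as a submodule the sequence $0\to A\to B\to B/A\to 0$ is $w$-pure exact. A module $M$ is $w$-FP-projective if $\mathrm{Ext}^1_R(M,A)=0$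 for every absolutely $w$-pure module $A$. The $w$-FP-projective dimension $w\text{-}\mathrm{fpd}_R(M)\in\mathbb N\cup\{\infty\}$ is the least integer $n\ge 0$ such that $\mathrm{Ext}^{n+1}_R(M,A)=0$ for every absolutely $w$-pure module $A$ ($\infty$ if there is no such $n$), and $w\text{-}\mathrm{fpD}(R)=\sup\{w\text{-}\mathrm{fpd}_R(M) : M \text{ a finitely generated } R\text{-module}\}$. Proposition. The following are equivalent: (1) $w\text{-}\mathrm{fpD}(R)=0$; (2) every $R$-module is $w$-FP-projective; (3) $R/I$ is $w$-FP-projective for every ideal $I$ of $R$; (4) every absolutely $w$-pure $R$-module is injective; (5) $R$ is a Noetherian DW-ring. -/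

import Mathlib

universe u v w x

open CategoryTheory TensorProduct

noncomputable section

namespace WFP

variable (R : Type u) [CommRing R]

/-- The natural homomorphism `R → J* = Hom_R(J, R)`, sending `r` to multiplication by `r` on `J`. -/
def toDual {R : Type u} [CommRing R] (J : Ideal R) : R →ₗ[R] (J →ₗ[R] R) :=
  LinearMap.toSpanSingleton R (J →ₗ[R] R) (Submodule.subtype J)

/-- Glaz–Vasconcelos ideals. -/
def IsGV {R : Type u} [CommRing R] (J : Ideal R) : Prop :=
  J.FG ∧ Function.Bijective (toDual J)

/-- The element `x` is killed by some GV-ideal, i.e. `x ∈ tor_GV(M)`. -/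
def IsGVTorsionElement {M : Type v} [AddCommGroup M] [Module R M] (x : M) : Prop :=
  ∃ J : Ideal R, IsGV J ∧ ∀ a ∈ J, a • x = 0

/-- `tor_GV(M) = 0`. -/
def IsGVTorsionFree (M : Type v) [AddCommGroup M] [Module R M] : Prop :=
  ∀ x : M, IsGVTorsionElement R x → x = 0

/-- `Ext_R^n(M, N) = 0`. -/
def ExtVanishes (n : ℕ) (M N : Type u) [AddCommGroup M] [Module R M]
    [AddCommGroup N] [Module R N] : Prop :=
  Subsingleton (Abelian.Ext (ModuleCat.of R M) (ModuleCat.of R N) n)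

/-- `w`-modules: GV-torsion-free modules `M` with `Ext_R^1(R/J, M) = 0` for all GV-ideals `J`. -/
def IsWModule (M : Type u) [AddCommGroup M] [Module R M] : Prop :=
  IsGVTorsionFree R M ∧ ∀ J : Ideal R, IsGV J → ExtVanishes R 1 (R ⧸ J) M

/-- `w`-ideals: ideals that are `w`-modules. -/
def IsWIdeal {R : Type u} [CommRing R] (I : Ideal R) : Prop := IsWModule R I

/-- Maximal `w`-ideals: maximal elements among the proper `w`-ideals. -/
def IsMaximalWIdeal {R : Type u} [CommRing R] (p : Ideal R) : Prop :=
  Maximal (fun I : Ideal R => IsWIdeal I ∧ I ≠ ⊤) p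

/-- DW-rings: every ideal is a `w`-ideal. -/
def IsDWRing : Prop := ∀ I : Ideal R, IsWIdeal I

section Exactness

variable {A : Type v} {B : Type w} {C : Type x} [AddCommGroup A] [AddCommGroup B] [AddCommGroup C]
  [Module R A] [Module R B] [Module R C]

/-- `0 → A → B → C → 0` is `w`-exact: it becomes exact after localization at every maximal
`w`-ideal `p`. Maximal `w`-ideals are always prime, so the instance argument `p.IsPrime`,
needed to form the localization, excludes no `p`. -/
def IsWExact (f : A →ₗ[R] B) (g : B →ₗ[R] C) : Prop :=
  ∀ (p : Ideal R) [p.IsPrime], IsMaximalWIdeal p →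
    Function.Injective (LocalizedModule.map p.primeCompl f) ∧
    Function.Exact (LocalizedModule.map p.primeCompl f) (LocalizedModule.map p.primeCompl g) ∧
    Function.Surjective (LocalizedModule.map p.primeCompl g)

/-- `0 → A → B → C → 0` is `w`-pure exact: it is `w`-exact, and stays so after tensoring with
any `R`-module. -/
def IsWPureExact (f : A →ₗ[R] B) (g : B →ₗ[R] C) : Prop :=
  IsWExact R f g ∧
    ∀ (M : Type u) [AddCommGroup M] [Module R M], IsWExact R (f.rTensor M) (g.rTensor M)

end Exactness

/-- `w`-pure submodules. -/
def IsWPureSubmodule {B : Type v} [AddCommGroup B] [Module R B] (A : Submodule R B) : Prop :=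
  IsWPureExact R A.subtype A.mkQ

/-- Absolutely `w`-pure modules: `w`-pure in every module that contains them. -/
def IsAbsolutelyWPure (A : Type u) [AddCommGroup A] [Module R A] : Prop :=
  ∀ (B : Type u) [AddCommGroup B] [Module R B] (i : A →ₗ[R] B),
    Function.Injective i → IsWPureSubmodule R (LinearMap.range i)

/-- `w`-FP-projective modules. -/
def IsWFPProjective (M : Type u) [AddCommGroup M] [Module R M] : Prop :=
  ∀ (A : Type u) [AddCommGroup A] [Module R A], IsAbsolutelyWPure R A → ExtVanishes R 1 M A

/-- The `w`-FP-projective dimension of a module: the smallest `n` such that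
`Ext_R^{n+1}(M, A) = 0` for all absolutely `w`-pure `A`, and `⊤` if there is none. -/
def wfpd (M : Type u) [AddCommGroup M] [Module R M] : ℕ∞ :=
  ⨅ (n : ℕ) (_ : ∀ (A : Type u) [AddCommGroup A] [Module R A],
    IsAbsolutelyWPure R A → ExtVanishes R (n + 1) M A), (n : ℕ∞)

/-- The `w`-FP-projective dimension of a ring: the supremum of the dimensions of its finitely
generated modules. -/
def wfpD : ℕ∞ :=
  ⨆ (M : ModuleCat.{u} R) (_ : Module.Finite R M), wfpd R M

end WFP

end

/-!
Absolutely `w`-pure modules are injective as soon as `Ext¹(R ⧸ I, -)` kills them (Baer), which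
links the first four conditions.

If every absolutely `w`-pure module is injective, then so is every direct sum of injectives, as it
is absolutely pure, and `R` is Noetherian by the Bass–Papp argument. Moreover, a GV-ideal `J` lies
in no maximal `w`-ideal, so a module killed by `J` is absolutely `w`-pure, because its localizations
at maximal `w`-ideals vanish. In particular `J ⧸ J ^ 2` is injective; the projection
`J → J ⧸ J ^ 2` extends to `R`, hence is multiplication by an element killed by `J`, hence is zero.
So `J = J ^ 2`, and by Nakayama some `r ∈ 1 + J` kills `J`. Injectivity of `R → Hom(J, R)` gives
`r = 0`, that is `J = R`.

Conversely, over a DW-ring all maximal ideals are maximal `w`-ideals, so absolutely `w`-pure modules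
are absolutely pure. These are closed under solving finite linear systems, which is Baer's criterion
for finitely generated ideals.
-/

namespace WFP

open Function DirectSum

section InjectiveModules

theorem exists_injective_embedding (R : Type u) [Ring R] [Small.{v} R] (M : Type v)
    [AddCommGroup M] [Module R M] :
    ∃ (E : ModuleCat.{v} R) (i : M →ₗ[R] E), Module.Injective R E ∧ Injective i := by
  obtain ⟨P⟩ := EnoughInjectives.presentation (ModuleCat.of R M)
  have := P.injective
  have := P.mono
  exact ⟨P.J, P.f.hom, Module.injective_module_of_injective_object R P.J,
    (ModuleCat.mono_iff_injective _).1 inferInstance⟩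

variable {R : Type u} [Ring R]

theorem exists_directSum_lift {ι : Type w} {E : ι → Type v} [∀ n, AddCommGroup (E n)]
    [∀ n, Module R (E n)] {M : Type x} [AddCommGroup M] [Module R M] (F : M →ₗ[R] ∀ n, E n)
    (hF : ∀ m, {n | F m n ≠ 0}.Finite) : ∃ G : M →ₗ[R] ⨁ n, E n, ∀ m n, G m n = F m n := by
  classical
  let G (m : M) : ⨁ n, E n := DFinsupp.mk (hF m).toFinset fun n ↦ F m n
  have hG (m : M) (n : ι) : G m n = F m n := by
    by_cases hn : F m n = 0 <;> simp [G, hn]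
  refine ⟨{ toFun := G, map_add' := fun a b ↦ ?_, map_smul' := fun r a ↦ ?_ }, hG⟩
  · ext n
    simp only [DirectSum.add_apply, hG, map_add, Pi.add_apply]
  · ext n
    simp only [DirectSum.smul_apply, hG, map_smul, Pi.smul_apply, RingHom.id_apply]

theorem exists_finset_forall_directSum_apply_eq_zero {ι : Type w} {E : ι → Type v}
    [∀ n, AddCommGroup (E n)] [∀ n, Module R (E n)] [Small.{max w v} R]
    [Module.Injective R (⨁ n, E n)] {I : Ideal R} (f : I →ₗ[R] ⨁ n, E n) :
    ∃ s : Finset ι, ∀ n ∉ s, ∀ x, f x n = 0 := by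
  classical
  obtain ⟨g, rfl⟩ := Module.Injective.extension_property R _ _ _ I.subtype I.subtype_injective f
  refine ⟨(g 1).support, fun n hn x ↦ ?_⟩
  have hgx : g x = (x : R) • g 1 := by rw [← map_smul, smul_eq_mul, mul_one]
  rw [LinearMap.comp_apply, Submodule.subtype_apply, hgx, DirectSum.smul_apply,
    DFinsupp.notMem_support_iff.1 hn, smul_zero]

theorem isNoetherianRing_of_injective_directSum
    (h : ∀ (E : ℕ → Type u) [∀ n, AddCommGroup (E n)] [∀ n, Module R (E n)],
      (∀ n, Module.Injective R (E n)) → Module.Injective R (⨁ n, E n)) :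
    IsNoetherianRing R := by
  rw [isNoetherianRing_iff, ← monotone_stabilizes_iff_noetherian]
  intro c
  choose E i hE hi using fun n ↦ exists_injective_embedding R (R ⧸ c n)
  let I : Ideal R := ⨆ n, c n
  let F : I →ₗ[R] ∀ n, E n := LinearMap.pi fun n ↦ i n ∘ₗ (c n).mkQ ∘ₗ I.subtype
  have hF (x : I) (n : ℕ) : F x n = 0 ↔ (x : R) ∈ c n :=
    (map_eq_zero_iff _ (hi n)).trans (Submodule.Quotient.mk_eq_zero (c n))
  have hF_finite (x : I) : {n | F x n ≠ 0}.Finite := by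
    obtain ⟨k, hk⟩ := (Submodule.mem_iSup_of_directed _ c.monotone.directed_le).1 x.2
    refine (Set.finite_Iio k).subset fun n hn ↦ ?_
    refine Set.mem_Iio.2 (not_le.1 fun hkn ↦ hn ?_)
    exact (hF x n).2 (c.monotone hkn hk)
  obtain ⟨G, hG⟩ := exists_directSum_lift F hF_finite
  have := h (fun n ↦ E n) hE
  obtain ⟨s, hs⟩ := exists_finset_forall_directSum_apply_eq_zero G
  obtain ⟨k, hk⟩ := s.exists_nat_subset_range
  have hI_le (n : ℕ) (hn : k ≤ n) : I ≤ c n := fun x hx ↦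
    (hF ⟨x, hx⟩ n).1 <| hG ⟨x, hx⟩ n ▸ hs n (fun hns ↦ hn.not_gt (Finset.mem_range.1 (hk hns))) _
  exact ⟨k, fun n hn ↦ (c.monotone hn).antisymm ((le_iSup c n).trans (hI_le k le_rfl))⟩

end InjectiveModules

section Ext

variable {R : Type u} [CommRing R] (M A : Type u) [AddCommGroup M] [Module R M] [AddCommGroup A]
  [Module R A]

theorem extVanishes_of_injective [Module.Injective R A] (n : ℕ) : ExtVanishes R (n + 1) M A :=
  have := Module.injective_object_of_injective_module R A
  Abelian.Ext.subsingleton_of_injective _ _ n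

theorem extVanishes_of_subsingleton [Subsingleton M] (n : ℕ) : ExtVanishes R n M A :=
  have := (ModuleCat.isZero_of_subsingleton (ModuleCat.of R M)).hasProjectiveDimensionLT_zero
  HasProjectiveDimensionLT.subsingleton _ 0 n n.zero_le _

variable {M A}

theorem exists_comp_subtype_eq_of_extVanishes {N : Submodule R M} (h : ExtVanishes R 1 (M ⧸ N) A)
    (f : N →ₗ[R] A) : ∃ g : M →ₗ[R] A, g ∘ₗ N.subtype = f := by
  let S := ModuleCat.shortComplexOfCompEqZero N.subtype N.mkQ
    (LinearMap.exact_subtype_mkQ N).linearMap_comp_eq_zero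
  have hS : S.ShortExact := ModuleCat.shortComplex_shortExact S (LinearMap.exact_subtype_mkQ N)
    N.subtype_injective N.mkQ_surjective
  have : Subsingleton (Abelian.Ext S.X₃ (ModuleCat.of R A) 1) := h
  obtain ⟨e, he⟩ := Abelian.Ext.contravariant_sequence_exact₁ hS (ModuleCat.of R A)
    (Abelian.Ext.mk₀ (ModuleCat.ofHom f)) (n₁ := 1) rfl (Subsingleton.elim _ _)
  obtain ⟨g, rfl⟩ := (Abelian.Ext.mk₀_bijective _ _).2 e
  rw [Abelian.Ext.mk₀_comp_mk₀] at he
  exact ⟨g.hom, congrArg ModuleCat.Hom.hom ((Abelian.Ext.mk₀_bijective _ _).1 he)⟩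

theorem injective_of_forall_extVanishes (h : ∀ I : Ideal R, ExtVanishes R 1 (R ⧸ I) A) :
    Module.Injective R A := by
  refine Module.Baer.injective fun I f ↦ ?_
  obtain ⟨g, rfl⟩ := exists_comp_subtype_eq_of_extVanishes (h I) f
  exact ⟨g, fun _ _ ↦ rfl⟩

end Ext

section Dimension

variable (R : Type u) [CommRing R]

theorem wfpd_eq_zero_iff (M : Type u) [AddCommGroup M] [Module R M] :
    wfpd R M = 0 ↔ IsWFPProjective R M := by
  simp [wfpd, IsWFPProjective]

theorem wfpD_eq_zero_iff : wfpD R = 0 ↔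
    ∀ (M : Type u) [AddCommGroup M] [Module R M] [Module.Finite R M], IsWFPProjective R M := by
  simp only [wfpD, ← bot_eq_zero, iSup₂_eq_bot]
  simp only [bot_eq_zero, wfpd_eq_zero_iff]
  exact ⟨fun h M _ _ hM ↦ h (ModuleCat.of R M) hM, fun h M _ ↦ h M⟩

end Dimension

section GVIdeals

variable {R : Type u} [CommRing R] {I J : Ideal R}

theorem IsWIdeal.eq_top_of_isGV_le (hI : IsWIdeal I) (hJ : IsGV J) (hJI : J ≤ I) : I = ⊤ := by
  obtain ⟨g, hg⟩ := exists_comp_subtype_eq_of_extVanishes (hI.2 J hJ) (Submodule.inclusion hJI)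
  have hdual : toDual J (g 1) = toDual J 1 := by
    ext x
    have hgx : g x = (x : R) • g 1 := by rw [← map_smul, smul_eq_mul, mul_one]
    have hx : (g x : R) = x := congr_arg Subtype.val (LinearMap.congr_fun hg x)
    simpa [toDual, hgx, mul_comm] using hx
  exact (Ideal.eq_top_iff_one I).2 (hJ.2.1 hdual ▸ (g 1).2)

theorem isDWRing_iff_forall_isGV_eq_top : IsDWRing R ↔ ∀ J : Ideal R, IsGV J → J = ⊤ := by
  refine ⟨fun h J hJ ↦ (h J).eq_top_of_isGV_le hJ le_rfl, fun h I ↦ ⟨?_, fun J hJ ↦ ?_⟩⟩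
  · rintro x ⟨J, hJ, hx⟩
    simpa using hx 1 (h J hJ ▸ Submodule.mem_top)
  · have := Ideal.Quotient.subsingleton_iff.2 (h J hJ)
    exact extVanishes_of_subsingleton _ _ 1

theorem IsDWRing.isMaximalWIdeal (h : IsDWRing R) {m : Ideal R} (hm : m.IsMaximal) :
    IsMaximalWIdeal m :=
  ⟨⟨h m, hm.ne_top⟩, fun _ hI hmI ↦ (hm.eq_of_le hI.2 hmI).ge⟩

theorem isIdempotentElem_of_injective_cotangent [Module.Injective R I.Cotangent] :
    IsIdempotentElem I := by
  obtain ⟨g, hg⟩ := Module.Injective.extension_property R _ _ _ I.subtype I.subtype_injective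
    I.toCotangent
  have hzero (x : I) : I.toCotangent x = 0 := by
    rw [← hg, LinearMap.comp_apply, Submodule.subtype_apply, ← mul_one (x : R), ← smul_eq_mul,
      map_smul, Ideal.Cotangent.smul_eq_zero_of_mem x.2]
  rw [← I.cotangent_subsingleton_iff]
  exact subsingleton_of_forall_eq 0 (I.toCotangent_surjective.forall.2 hzero)

theorem IsGV.eq_top_of_isIdempotentElem (hJ : IsGV J) (hJJ : IsIdempotentElem J) : J = ⊤ := by
  obtain ⟨r, hr, hrJ⟩ :=
    Submodule.exists_sub_one_mem_and_smul_eq_zero_of_fg_of_le_smul J J hJ.1 hJJ.ge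
  have hr_zero : r = 0 := hJ.2.1 <| by
    ext x
    simpa [toDual] using hrJ x x.2
  rw [Ideal.eq_top_iff_one]
  simpa [hr_zero] using hr

end GVIdeals

section AbsolutelyPure

variable {R : Type u} [CommRing R]

variable (R) in
/-- Absolutely pure (FP-injective) modules: every embedding into another module is pure, that is,
stays injective after tensoring with an arbitrary module. The test modules `M` range over the
universe of `R`, which contains all finitely presented modules up to isomorphism. -/
def IsAbsolutelyPure (A : Type v) [AddCommGroup A] [Module R A] : Prop :=
  ∀ (B : Type v) [AddCommGroup B] [Module R B] (i : A →ₗ[R] B), Injective i →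
    ∀ (M : Type u) [AddCommGroup M] [Module R M], Injective (i.rTensor M)

theorem directSumLeft_apply {ι : Type w} [DecidableEq ι] (E : ι → Type v)
    [∀ n, AddCommGroup (E n)] [∀ n, Module R (E n)] (M : Type x) [AddCommGroup M] [Module R M]
    (z : (⨁ n, E n) ⊗[R] M) (n : ι) :
    TensorProduct.directSumLeft R R E M z n = (component R ι E n).rTensor M z := by
  induction z with
  | zero => simp
  | tmul a m => simp [TensorProduct.directSumLeft_tmul, DirectSum.apply_eq_component R a]
  | add a b ha hb => rw [map_add, map_add, DirectSum.add_apply, ha, hb]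

theorem isAbsolutelyPure_directSum {ι : Type w} {E : ι → Type v} [∀ n, AddCommGroup (E n)]
    [∀ n, Module R (E n)] [Small.{v} R] (hE : ∀ n, Module.Injective R (E n)) :
    IsAbsolutelyPure R (⨁ n, E n) := by
  classical
  intro B _ _ i hi M _ _
  rw [injective_iff_map_eq_zero]
  intro z hz
  rw [← (TensorProduct.directSumLeft R R E M).map_eq_zero_iff]
  ext n
  obtain ⟨r, hr⟩ := Module.Injective.extension_property R _ _ _ i hi (component R ι E n)
  rw [directSumLeft_apply, ← hr, LinearMap.rTensor_comp_apply, hz, map_zero,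
    DirectSum.zero_apply]

theorem sum_smul_mkQ_single {ι : Type*} [Fintype ι] [DecidableEq ι] (N : Submodule R (ι → R))
    (v : ι → R) : ∑ k, v k • N.mkQ (Pi.single k 1) = N.mkQ v := by
  simp only [← map_smul, ← map_sum]
  rw [← pi_eq_sum_univ' v]

theorem exists_solution_of_sum_tmul_mkQ_single_eq_zero {ι κ : Type*} [Fintype ι] [DecidableEq ι]
    [Fintype κ] (c : Matrix ι κ R) {A : Type*} [AddCommGroup A] [Module R A] {a : ι → A}
    (ha : ∑ k, a k ⊗ₜ[R] (LinearMap.range c.mulVecLin).mkQ (Pi.single k 1) = 0) :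
    ∃ y : κ → A, ∀ k, a k = ∑ j, c k j • y j := by
  let N := LinearMap.range c.mulVecLin
  let e (k : ι) : (ι → R) ⧸ N := N.mkQ (Pi.single k 1)
  have span_e : Submodule.span R (Set.range e) = ⊤ := by
    refine top_unique fun q _ ↦ ?_
    obtain ⟨v, rfl⟩ := N.mkQ_surjective q
    rw [← sum_smul_mkQ_single]
    exact Submodule.sum_smul_mem _ _ fun k _ ↦ Submodule.subset_span ⟨k, rfl⟩
  have sum_e_tmul_a : ∑ k, e k ⊗ₜ[R] a k = 0 := by
    simpa [e, N] using congrArg (TensorProduct.comm R A _) ha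
  obtain ⟨m, d, y, ha, hd⟩ := TensorProduct.vanishesTrivially_of_sum_tmul_eq_zero R span_e
    sum_e_tmul_a
  have hd_mem (l : Fin m) : (fun k ↦ d k l) ∈ N := by
    rw [← Submodule.Quotient.mk_eq_zero, ← Submodule.mkQ_apply, ← sum_smul_mkQ_single, hd]
  choose z hz using hd_mem
  have hdz (k : ι) (l : Fin m) : d k l = ∑ j, c k j * z l j := (congr_fun (hz l) k).symm
  refine ⟨fun j ↦ ∑ l, z l j • y l, fun k ↦ ?_⟩
  simp only [ha k, hdz, Finset.sum_smul, Finset.smul_sum, mul_smul]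
  exact Finset.sum_comm

theorem exists_solution_of_rTensor_coker_injective {ι κ : Type*} [Finite ι] [Fintype κ]
    (c : Matrix ι κ R) {A B : Type*} [AddCommGroup A] [Module R A] [AddCommGroup B]
    [Module R B] {i : A →ₗ[R] B}
    (hi : Injective (i.rTensor ((ι → R) ⧸ LinearMap.range c.mulVecLin)))
    {a : ι → A} {b : κ → B} (hb : ∀ k, i (a k) = ∑ j, c k j • b j) :
    ∃ y : κ → A, ∀ k, a k = ∑ j, c k j • y j := by
  classical
  have := Fintype.ofFinite ι
  let N := LinearMap.range c.mulVecLin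
  have sum_col_smul (j : κ) : ∑ k, c k j • N.mkQ (Pi.single k 1) = 0 := by
    rw [sum_smul_mkQ_single N fun k ↦ c k j, Submodule.mkQ_apply, Submodule.Quotient.mk_eq_zero]
    exact ⟨Pi.single j 1, Matrix.mulVec_single_one c j⟩
  refine exists_solution_of_sum_tmul_mkQ_single_eq_zero c (hi ?_)
  simp only [map_zero, map_sum, LinearMap.rTensor_tmul, hb, TensorProduct.sum_tmul,
    TensorProduct.smul_tmul]
  rw [Finset.sum_comm]
  simp only [← TensorProduct.tmul_sum, N, sum_col_smul, TensorProduct.tmul_zero,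
    Finset.sum_const_zero]

theorem IsAbsolutelyPure.exists_comp_subtype_eq [Small.{v} R] {A : Type v} [AddCommGroup A]
    [Module R A] (hA : IsAbsolutelyPure R A) {I : Ideal R} (hI : I.FG) (f : I →ₗ[R] A) :
    ∃ g : R →ₗ[R] A, g ∘ₗ I.subtype = f := by
  obtain ⟨E, i, hE, hi⟩ := exists_injective_embedding R A
  obtain ⟨g, hg⟩ := Module.Injective.extension_property R _ _ _ I.subtype I.subtype_injective
    (i ∘ₗ f)
  have : Module.Finite R I := Module.Finite.iff_fg.2 hI
  obtain ⟨n, s, hs⟩ := Module.Finite.exists_fin (R := R) (M := I)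
  have hgs (k : Fin n) : i (f (s k)) = (s k : R) • g 1 := by
    rw [← map_smul, smul_eq_mul, mul_one]
    exact (LinearMap.congr_fun hg (s k)).symm
  obtain ⟨y, hy⟩ := exists_solution_of_rTensor_coker_injective
    (Matrix.replicateCol Unit fun k ↦ (s k : R)) (hA E i hi _) (a := f ∘ s) (b := fun _ ↦ g 1)
    (by simpa using hgs)
  refine ⟨LinearMap.toSpanSingleton R A (y ()), LinearMap.ext_on_range hs fun k ↦ ?_⟩
  simpa using (hy k).symm

theorem IsAbsolutelyPure.injective [IsNoetherianRing R] [Small.{v} R] {A : Type v}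
    [AddCommGroup A] [Module R A] (hA : IsAbsolutelyPure R A) : Module.Injective R A := by
  refine Module.Baer.injective fun I f ↦ ?_
  obtain ⟨g, rfl⟩ := hA.exists_comp_subtype_eq (IsNoetherian.noetherian I) f
  exact ⟨g, fun _ _ ↦ rfl⟩

end AbsolutelyPure

section AbsolutelyWPure

theorem localizedModule_map_comp_equiv_injective_iff {R : Type u} [CommSemiring R] (S : Submonoid R)
    {M : Type v} {N : Type w} {P : Type x} [AddCommMonoid M] [Module R M] [AddCommMonoid N]
    [Module R N] [AddCommMonoid P] [Module R P] (e : M ≃ₗ[R] N) (f : N →ₗ[R] P) :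
    Injective (LocalizedModule.map S (f ∘ₗ e.toLinearMap)) ↔
      Injective (LocalizedModule.map S f) := by
  have he : Bijective (LocalizedModule.map S e.toLinearMap) :=
    ⟨LocalizedModule.map_injective S _ e.injective, LocalizedModule.map_surjective S _ e.surjective⟩
  have hcomp : LocalizedModule.map S (f ∘ₗ e.toLinearMap) =
      LocalizedModule.map S f ∘ LocalizedModule.map S e.toLinearMap := by
    ext z
    induction z using LocalizedModule.induction_on with | _ a s
    simp only [comp_apply, LocalizedModule.map_mk, LinearMap.comp_apply]
  rw [hcomp, Injective.of_comp_iff' _ he]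

variable {R : Type u} [CommRing R]

theorem isWExact_iff_injective {A : Type v} {B : Type w} {C : Type x} [AddCommGroup A]
    [AddCommGroup B] [AddCommGroup C] [Module R A] [Module R B] [Module R C]
    {f : A →ₗ[R] B} {g : B →ₗ[R] C} (hfg : Exact f g) (hg : Surjective g) :
    IsWExact R f g ↔ ∀ (p : Ideal R) [p.IsPrime], IsMaximalWIdeal p →
      Injective (LocalizedModule.map p.primeCompl f) :=
  ⟨fun h p _ hp ↦ (h p hp).1, fun h p _ hp ↦ ⟨h p hp,
    LocalizedModule.map_exact p.primeCompl f g hfg,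
    LocalizedModule.map_surjective p.primeCompl g hg⟩⟩

variable {A : Type u} [AddCommGroup A] [Module R A]

theorem isWPureSubmodule_iff {B : Type v} [AddCommGroup B] [Module R B] {N : Submodule R B} :
    IsWPureSubmodule R N ↔ ∀ (M : Type u) [AddCommGroup M] [Module R M] (p : Ideal R) [p.IsPrime],
      IsMaximalWIdeal p → Injective (LocalizedModule.map p.primeCompl (N.subtype.rTensor M)) := by
  have hexact := LinearMap.exact_subtype_mkQ N
  have hrTensor (M : Type u) [AddCommGroup M] [Module R M] :=
    isWExact_iff_injective (rTensor_exact M hexact N.mkQ_surjective)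
      (LinearMap.rTensor_surjective M N.mkQ_surjective)
  refine ⟨fun h M _ _ ↦ (hrTensor M).1 (h.2 M), fun h ↦ ⟨?_, fun M _ _ ↦ (hrTensor M).2 (h M)⟩⟩
  exact (isWExact_iff_injective hexact N.mkQ_surjective).2 fun p _ _ ↦
    LocalizedModule.map_injective p.primeCompl _ N.subtype_injective

theorem isAbsolutelyWPure_iff : IsAbsolutelyWPure R A ↔
    ∀ (B : Type u) [AddCommGroup B] [Module R B] (i : A →ₗ[R] B), Injective i →
      ∀ (M : Type u) [AddCommGroup M] [Module R M] (p : Ideal R) [p.IsPrime],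
        IsMaximalWIdeal p → Injective (LocalizedModule.map p.primeCompl (i.rTensor M)) := by
  refine forall₅_congr fun B _ _ i hi ↦ isWPureSubmodule_iff.trans ?_
  refine forall₅_congr fun M _ _ p _ ↦ forall_congr' fun _ ↦ ?_
  rw [← localizedModule_map_comp_equiv_injective_iff _ ((LinearEquiv.ofInjective i hi).rTensor M),
    LinearEquiv.coe_rTensor, ← LinearMap.rTensor_comp]
  rfl

theorem IsAbsolutelyPure.isAbsolutelyWPure (hA : IsAbsolutelyPure R A) : IsAbsolutelyWPure R A :=
  isAbsolutelyWPure_iff.2 fun B _ _ i hi M _ _ p _ _ ↦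
    LocalizedModule.map_injective p.primeCompl _ (hA B i hi M)

theorem IsAbsolutelyWPure.isAbsolutelyPure (hR : IsDWRing R) (hA : IsAbsolutelyWPure R A) :
    IsAbsolutelyPure R A := fun B _ _ i hi M _ _ ↦
  injective_of_localized_maximal _ fun m hm ↦
    isAbsolutelyWPure_iff.1 hA B i hi M m (hR.isMaximalWIdeal hm)

theorem IsGV.isAbsolutelyWPure_of_isTorsionBySet {J : Ideal R} (hJ : IsGV J)
    (hA : Module.IsTorsionBySet R A J) : IsAbsolutelyWPure R A := by
  refine isAbsolutelyWPure_iff.2 fun B _ _ i _ M _ _ p _ hp ↦ ?_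
  obtain ⟨r, hrJ, hrp⟩ := Set.not_subset.1 (mt (hp.1.1.eq_top_of_isGV_le hJ) hp.1.2)
  have hr (a : A) : r • a = 0 := hA (x := a) (a := ⟨r, hrJ⟩)
  have : Subsingleton (LocalizedModule p.primeCompl (A ⊗[R] M)) := by
    refine LocalizedModule.subsingleton_iff.2 fun z ↦ ⟨r, hrp, ?_⟩
    induction z with
    | zero => exact smul_zero _
    | tmul a m => rw [TensorProduct.smul_tmul', hr a, TensorProduct.zero_tmul]
    | add a b ha hb => rw [smul_add, ha, hb, add_zero]
  exact injective_of_subsingleton _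

end AbsolutelyWPure

end WFP

theorem mainTheorem3 (R : Type u) [CommRing R] :
    [ WFP.wfpD R = 0,
      ∀ (M : Type u) [AddCommGroup M] [Module R M], WFP.IsWFPProjective R M,
      ∀ I : Ideal R, WFP.IsWFPProjective R (R ⧸ I),
      ∀ (A : Type u) [AddCommGroup A] [Module R A],
        WFP.IsAbsolutelyWPure R A → Module.Injective R A,
      IsNoetherianRing R ∧ WFP.IsDWRing R ].TFAE := by
  tfae_have 2 → 1 := fun h ↦ (WFP.wfpD_eq_zero_iff R).2 fun M _ _ _ ↦ h M
  tfae_have 1 → 3 := fun h I ↦ (WFP.wfpD_eq_zero_iff R).1 h (R ⧸ I)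
  tfae_have 3 → 4 := fun h A _ _ hA ↦ WFP.injective_of_forall_extVanishes fun I ↦ h I A hA
  tfae_have 4 → 2 := fun h M _ _ A _ _ hA ↦
    have := h A hA
    WFP.extVanishes_of_injective M A 0
  tfae_have 4 → 5 := by
    refine fun h ↦ ⟨WFP.isNoetherianRing_of_injective_directSum fun E _ _ hE ↦ ?_,
      WFP.isDWRing_iff_forall_isGV_eq_top.2 fun J hJ ↦ ?_⟩
    · exact h _ (WFP.isAbsolutelyPure_directSum hE).isAbsolutelyWPure
    · have := h _ (hJ.isAbsolutelyWPure_of_isTorsionBySet J.isTorsionBySet_cotangent)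
      exact hJ.eq_top_of_isIdempotentElem WFP.isIdempotentElem_of_injective_cotangent
  tfae_have 5 → 4 := fun ⟨_, hR⟩ A _ _ hA ↦ (hA.isAbsolutelyPure hR).injective
  tfae_finish
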